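/- Let $\mathbb{T}=\mathbb{R}/2\pi\mathbb{Z}$ be the unit circle, parametrized by the angle and equipped with its normalized invariant measure $\frac{dx}{2\pi}$. For $f\in L^1(\mathbb{T})$ (complex-valued) and $k\in\mathbb{Z}$ let $\widehat f(k)=\frac1{2\pi}\int_0^{2\pi}f(x)e^{-ikx}\,dx$. For $1\le p\le 2$, $f\in L^p(\mathbb{T})$ and $t>0$ let \[ \omega_p[f](t)=\sup_{0<h<t}\Vert f(\cdot+h)+f(\cdot-h)-2f(\cdot)\Vert_{L^p(\mathbb{T})}, \] and for $p>1$ let $p'=\frac{p}{p-1}$ be the conjugate exponent. **Theorem.** Let $1\le p\le 2$. Then there is a constant $c_p>0$, depending only on $p$, such that for all $f\in L^p(\mathbb{T})$ and all $t>0$: - when $p=1$, \[ \sup_{k\in\mathbb{Z}}\left[\min\{1,(t|k|)^2\}\,|\widehat f(k)|\right]\le c_1\,\omega_1[f](t); \] - when $1<p<2$, \[ \left[\sum_{k\in\mathbb{Z}}\min\{1,(t|k|)^{2p'}\}\,|\widehat f(k)|^{p'}\right]^{1/p'}\le c_p\,\omega_p[f](t); \] - when $p=2$, \[ \left[\sum_{k\in\mathbb{Z}}\min\{1,(t|k|)^{4}\}\,|\widehat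 f(k)|^{2}\right]^{1/2}\asymp\omega_2[f](t), \] that is, the left-hand side is bounded above and below by positive absolute constants times the right-hand side. -/

import Mathlib

open MeasureTheory AddCircle
open scoped Real ENNReal

/-- The torus `𝕋 = ℝ / 2πℤ`, i.e. the unit circle parametrized by the angle. It carries the
normalized Haar measure `haarAddCircle` (total mass one), and
`fourierCoeff f k = ∫ f(x) e^{-ikx} d(haarAddCircle)`. -/
noncomputable abbrev Torus : Type := AddCircle (2 * π)

instance fact_zero_lt_two_pi : Fact (0 < 2 * π) := ⟨Real.two_pi_pos⟩

/-- The symmetric second difference `x ↦ f(x + h) + f(x - h) - 2 f(x)`. -/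
noncomputable def secondDiff (f : Torus → ℂ) (h : ℝ) : Torus → ℂ :=
  fun x => f (x + (h : Torus)) + f (x - (h : Torus)) - 2 * f x

/-- The second-difference `L^p` modulus of continuity
`ω_p[f](t) = sup_{0 < h < t} ‖f(· + h) + f(· - h) - 2 f(·)‖_p`, valued in `[0, ∞]`. -/
noncomputable def secondModulus (p : ℝ) (f : Torus → ℂ) (t : ℝ) : ℝ≥0∞ :=
  ⨆ h ∈ Set.Ioo 0 t, eLpNorm (secondDiff f h) (ENNReal.ofReal p) haarAddCircle

/-- For `1 ≤ s < ∞` and a weight exponent `a`, the weighted `ℓ^s` size of the Fourier coefficients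
`[∑_{k ∈ ℤ} min{1, (t|k|)^a} |f̂(k)|^s]^{1/s}`, valued in `[0, ∞]`. -/
noncomputable def weightedCoeffSum (a s : ℝ) (f : Torus → ℂ) (t : ℝ) : ℝ≥0∞ :=
  (∑' k : ℤ, ENNReal.ofReal (min 1 ((t * |(k : ℝ)|) ^ a) * ‖fourierCoeff f k‖ ^ s)) ^ (1 / s)

/-! The symmetric second difference with step `h` multiplies the `k`-th Fourier coefficient by `-(2
- 2 cos (k h))`, so coefficient bounds for `secondDiff f h` are weighted bounds for `f`.

For `1 < p ≤ 2`, Hausdorff–Young (Parseval if `p = 2`) bounds `∑ (2 - 2 cos (k h))^q |f̂(k)|^q` by a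
multiple of `ω_p[f](t)^q` for each `h` in `(0, t)`. The multiplier may vanish at particular `h`, so
the bound is averaged over `h`: the mean of the multiplier is `2 (1 - sin u / u)` with `u = t|k|`,
which is at least `min(1, u^2) / π^2` (`integral_two_sub_two_mul_cos_ge`). For `p = 1` each `k` is
treated alone and one good `h` suffices. The reverse bound at `p = 2` is Parseval with `2 - 2 cos x
≤ min(4, x^2)`.

Hausdorff–Young is needed only up to a constant, and follows by real interpolation between the `L^1`
bound and Bessel's inequality (`count_fourierCoeff_le`, `exists_hausdorffYoung`). -/

/-! ### Fourier coefficients of translates and second differences -/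

theorem integrable_comp_add_right {f : Torus → ℂ} (hf : Integrable f haarAddCircle) (a : Torus) :
    Integrable (fun x => f (x + a)) haarAddCircle :=
  (measurePreserving_add_right haarAddCircle a).integrable_comp_of_integrable hf

theorem fourierCoeff_comp_add_right (f : Torus → ℂ) (a : Torus) (k : ℤ) :
    fourierCoeff (fun x => f (x + a)) k = fourier k a * fourierCoeff f k := by
  have h := integral_add_right_eq_self (μ := haarAddCircle)
    (fun x : Torus => fourier (-k) (x - a) • f x) a
  simp only [add_sub_cancel_right] at h
  rw [fourierCoeff, h, fourierCoeff, ← integral_const_mul]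
  refine integral_congr_ae (.of_forall fun x => ?_)
  have : (fourier (-k) (x - a) : ℂ) = fourier k a * fourier (-k) x := by
    simp only [fourier_apply, smul_sub, neg_smul, sub_neg_eq_add, ← Circle.coe_mul,
      ← toCircle_add]
    congr 2
    abel
  simp only [this, smul_eq_mul, mul_assoc]

theorem fourier_torus_apply (k : ℤ) (h : ℝ) :
    (fourier k (h : Torus) : ℂ) = Complex.exp (((k * h : ℝ) : ℂ) * Complex.I) := by
  rw [fourier_coe_apply]
  congr 1
  have : (π : ℂ) ≠ 0 := by exact_mod_cast Real.pi_ne_zero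
  push_cast
  field_simp

theorem fourierCoeff_secondDiff {f : Torus → ℂ} (hf : Integrable f haarAddCircle) (h : ℝ) (k : ℤ) :
    fourierCoeff (secondDiff f h) k = -((2 - 2 * Real.cos (k * h) : ℝ) : ℂ) * fourierCoeff f k := by
  have e : secondDiff f h = ((fun x => f (x + (h : Torus))) + fun x => f (x + ((-h : ℝ) : Torus))) +
      (-2 : ℂ) • f := by
    ext x
    simp [secondDiff, sub_eq_add_neg]
  rw [e, fourierCoeff.add ((integrable_comp_add_right hf _).add (integrable_comp_add_right hf _))
    (hf.smul _), fourierCoeff.add (integrable_comp_add_right hf _) (integrable_comp_add_right hf _),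
    Pi.add_apply, Pi.add_apply, fourierCoeff.const_smul]
  rw [fourierCoeff_comp_add_right, fourierCoeff_comp_add_right, fourier_torus_apply,
    fourier_torus_apply]
  push_cast
  rw [Complex.cos]
  simp only [smul_eq_mul, mul_neg, neg_mul]
  ring

theorem two_sub_two_mul_cos_nonneg (x : ℝ) : 0 ≤ 2 - 2 * Real.cos x := by
  linarith [Real.cos_le_one x]

theorem norm_fourierCoeff_secondDiff {f : Torus → ℂ} (hf : Integrable f haarAddCircle) (h : ℝ)
    (k : ℤ) :
    ‖fourierCoeff (secondDiff f h) k‖ = (2 - 2 * Real.cos (k * h)) * ‖fourierCoeff f k‖ := by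
  rw [fourierCoeff_secondDiff hf, norm_mul, norm_neg, Complex.norm_real, Real.norm_of_nonneg
    (two_sub_two_mul_cos_nonneg _)]

theorem memLp_secondDiff {f : Torus → ℂ} {p : ℝ≥0∞} (hf : MemLp f p haarAddCircle) (h : ℝ) :
    MemLp (secondDiff f h) p haarAddCircle := by
  have h1 := hf.comp_measurePreserving (measurePreserving_add_right haarAddCircle (h : Torus))
  have h2 := hf.comp_measurePreserving (measurePreserving_sub_right haarAddCircle (h : Torus))
  exact (h1.add h2).sub (hf.const_mul 2)

/-! ### The `L^1` and `L^2` bounds on Fourier coefficients -/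

theorem enorm_fourierCoeff_le_lintegral (g : Torus → ℂ) (k : ℤ) :
    ‖fourierCoeff g k‖ₑ ≤ ∫⁻ x, ‖g x‖ₑ ∂haarAddCircle := by
  refine (enorm_integral_le_lintegral_enorm _).trans (lintegral_mono fun x => ?_)
  rw [enorm_smul, fourier_apply, ← ofReal_norm, Circle.norm_coe, ENNReal.ofReal_one, one_mul]

theorem tsum_enorm_fourierCoeff_sq {g : Torus → ℂ} (hg : MemLp g 2 haarAddCircle) :
    ∑' k : ℤ, ‖fourierCoeff g k‖ₑ ^ (2 : ℝ) = ∫⁻ x, ‖g x‖ₑ ^ (2 : ℝ) ∂haarAddCircle := by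
  have H := hasSum_sq_fourierCoeff (hg.toLp g)
  rw [fourierCoeff_congr_ae hg.coeFn_toLp] at H
  have e : ∫ t, ‖hg.toLp g t‖ ^ 2 ∂haarAddCircle = ∫ t, ‖g t‖ ^ 2 ∂haarAddCircle :=
    integral_congr_ae (hg.coeFn_toLp.mono fun x hx => by simp only [hx])
  rw [e] at H
  have c : ∀ z : ℂ, ‖z‖ₑ ^ (2 : ℝ) = ENNReal.ofReal (‖z‖ ^ 2) := fun z => by
    rw [ENNReal.ofReal_pow (norm_nonneg _), ofReal_norm]
    exact ENNReal.rpow_natCast _ 2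
  simp only [c]
  rw [← ENNReal.ofReal_tsum_of_nonneg (fun k => by positivity) H.summable, H.tsum_eq,
    ofReal_integral_eq_lintegral_ofReal hg.norm.integrable_sq (.of_forall fun x => by positivity)]

theorem tsum_enorm_fourierCoeff_sq_le {g : Torus → ℂ}
    (hg : AEStronglyMeasurable g haarAddCircle) :
    ∑' k : ℤ, ‖fourierCoeff g k‖ₑ ^ (2 : ℝ) ≤ ∫⁻ x, ‖g x‖ₑ ^ (2 : ℝ) ∂haarAddCircle := by
  by_cases h : MemLp g 2 haarAddCircle
  · exact (tsum_enorm_fourierCoeff_sq h).le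
  · have : ∫⁻ x, ‖g x‖ₑ ^ (2 : ℝ) ∂haarAddCircle = ∞ := by
      by_contra hne
      refine h ⟨hg, ?_⟩
      rw [eLpNorm_lt_top_iff_lintegral_rpow_enorm_lt_top (by simp) (by simp)]
      simpa using lt_top_iff_ne_top.2 hne
    rw [this]
    exact le_top

/-! ### The Hausdorff-Young inequality up to a constant -/

theorem lintegral_indicator_rpow {a r : ℝ} (ha : 0 < a) (hr : 0 < r) :
    ∫⁻ s in Set.Ioi (0 : ℝ), (Set.Iic a).indicator (fun s => ENNReal.ofReal (s ^ (r - 1))) s =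
      ENNReal.ofReal (a ^ r / r) := by
  rw [lintegral_indicator measurableSet_Iic, Measure.restrict_restrict measurableSet_Iic,
    Set.inter_comm, Set.Ioi_inter_Iic, ← ofReal_integral_eq_lintegral_ofReal,
    ← intervalIntegral.integral_of_le ha.le, integral_rpow (Or.inl (by linarith))]
  · simp [hr.ne']
  · exact (intervalIntegrable_iff_integrableOn_Ioc_of_le ha.le).1
      (intervalIntegral.intervalIntegrable_rpow' (by linarith))
  · filter_upwards [ae_restrict_mem measurableSet_Ioc] with s hs
    exact Real.rpow_nonneg hs.1.le _

/-- The sublevel set at which a function is truncated at height `s` of its Fourier coefficients. -/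
def truncationSet (p : ℝ) (g : Torus → ℂ) (s : ℝ) : Set Torus :=
  {x | s * ‖g x‖ ^ (p - 1) ≤ 2}

theorem measurableSet_truncationSet {p : ℝ} {g : Torus → ℂ} (hg : Measurable g) (s : ℝ) :
    MeasurableSet (truncationSet p g s) :=
  measurableSet_le ((hg.norm.pow_const _).const_mul _) measurable_const

/-- Off the truncation set `s |g|^(p-1) > 2`, hence `|g| ≤ (s/2) |g|^p`. -/
theorem lintegral_compl_truncationSet_le {p s : ℝ} {g : Torus → ℂ} (hp : 1 < p)
    (h1 : ∫⁻ x, ‖g x‖ₑ ^ p ∂haarAddCircle ≤ 1) (hs : 0 < s) :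
    ∫⁻ x, ‖(truncationSet p g s)ᶜ.indicator g x‖ₑ ∂haarAddCircle ≤ ENNReal.ofReal (s / 2) := by
  calc _ ≤ ∫⁻ x, ENNReal.ofReal (s / 2) * ‖g x‖ₑ ^ p ∂haarAddCircle := by
        refine lintegral_mono fun x => ?_
        by_cases hx : x ∈ truncationSet p g s
        · simp [hx]
        · rw [Set.indicator_of_mem (by exact hx)]
          replace hx : 2 < s * ‖g x‖ ^ (p - 1) := not_le.1 hx
          rw [← ofReal_norm, ENNReal.ofReal_rpow_of_nonneg (norm_nonneg _) (by linarith),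
            ← ENNReal.ofReal_mul (by positivity)]
          refine ENNReal.ofReal_le_ofReal ?_
          have h0 : 0 < ‖g x‖ := by
            rcases (norm_nonneg (g x)).eq_or_lt with h | h
            · rw [← h, Real.zero_rpow (by linarith)] at hx
              linarith
            · exact h
          rw [show p = 1 + (p - 1) by ring, Real.rpow_add h0, Real.rpow_one]
          nlinarith
    _ ≤ _ := by
        rw [lintegral_const_mul' _ _ ENNReal.ofReal_ne_top]
        exact mul_le_of_le_one_right' h1

/-- The large part of `g` contributes at most `s/2` to any coefficient, so a coefficient above `s`
forces the truncated part to have one above `s/2`; Chebyshev and Bessel count these. -/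
theorem count_fourierCoeff_le {p s : ℝ} {g : Torus → ℂ} (hp : 1 < p) (hg : Measurable g)
    (hi : Integrable g haarAddCircle)
    (h1 : ∫⁻ x, ‖g x‖ₑ ^ p ∂haarAddCircle ≤ 1) (hs : 0 < s) :
    ENNReal.ofReal (s / 2) ^ (2 : ℝ) * Measure.count {k : ℤ | s < ‖fourierCoeff g k‖} ≤
      ∫⁻ x, (truncationSet p g s).indicator (fun x => ‖g x‖ₑ ^ (2 : ℝ)) x ∂haarAddCircle := by
  set S := truncationSet p g s
  have hS : MeasurableSet S := measurableSet_truncationSet hg s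
  have hle := tsum_enorm_fourierCoeff_sq_le (hg.indicator hS).aestronglyMeasurable
  have e : ∀ x, ‖S.indicator g x‖ₑ ^ (2 : ℝ) = S.indicator (fun x => ‖g x‖ₑ ^ (2 : ℝ)) x := by
    intro x
    by_cases hx : x ∈ S <;> simp [hx]
  simp only [e] at hle
  refine le_trans ?_ hle
  rw [← lintegral_count]
  refine le_trans ?_ (mul_meas_ge_le_lintegral (measurable_of_countable _)
    (ENNReal.ofReal (s / 2) ^ (2 : ℝ)))
  refine mul_le_mul_right (measure_mono fun k (hk : s < ‖fourierCoeff g k‖) => ?_) _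
  refine ENNReal.rpow_le_rpow ?_ (by norm_num)
  have hsum : fourierCoeff g k = fourierCoeff (S.indicator g) k + fourierCoeff (Sᶜ.indicator g) k := by
    conv_lhs => rw [← Set.indicator_self_add_compl S g]
    rw [fourierCoeff.add (hi.indicator hS) (hi.indicator hS.compl)]
    rfl
  have hc := (enorm_fourierCoeff_le_lintegral _ k).trans
    (lintegral_compl_truncationSet_le hp h1 hs)
  rw [← ofReal_norm, ENNReal.ofReal_le_ofReal_iff (by positivity)] at hc ⊢
  have := norm_add_le (fourierCoeff (S.indicator g) k) (fourierCoeff (Sᶜ.indicator g) k)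
  rw [← hsum] at this
  linarith

/-- A point `x` with `g x ≠ 0` lies in the truncation set exactly when `s ≤ 2 |g x|^(1-p)`. Since `q
> 2` the power of `s` is integrable at `0`, and conjugacy gives `2 + (1-p)(q-2) = p`. -/
theorem lintegral_truncationSet_indicator_le {p q : ℝ} (hq : 2 < q)
    (hpq : p.HolderConjugate q) (g : Torus → ℂ) (x : Torus) :
    ∫⁻ s in Set.Ioi (0 : ℝ), 4 * ENNReal.ofReal (s ^ (q - 2 - 1)) *
        (truncationSet p g s).indicator (fun x => ‖g x‖ₑ ^ (2 : ℝ)) x ≤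
      ENNReal.ofReal (4 * (2 ^ (q - 2) / (q - 2))) * ‖g x‖ₑ ^ p := by
  rcases eq_or_ne (g x) 0 with h0 | h0
  · have : ∀ s, (truncationSet p g s).indicator (fun x => ‖g x‖ₑ ^ (2 : ℝ)) x = 0 :=
      fun s => Set.indicator_apply_eq_zero.2 fun _ => by simp [h0]
    simp only [this, mul_zero, lintegral_zero, zero_le]
  have hn : 0 < ‖g x‖ := norm_pos_iff.2 h0
  set a := 2 * ‖g x‖ ^ (1 - p) with ha
  have ha0 : 0 < a := by positivity
  have hmem : ∀ s, x ∈ truncationSet p g s ↔ s ∈ Set.Iic a := fun s => by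
    simp only [truncationSet, Set.mem_ofPred_eq, Set.mem_Iic, ha]
    rw [show 1 - p = -(p - 1) by ring, Real.rpow_neg hn.le, ← div_eq_mul_inv,
      le_div_iff₀ (by positivity)]
  have e : ∀ s, 4 * ENNReal.ofReal (s ^ (q - 2 - 1)) *
      (truncationSet p g s).indicator (fun x => ‖g x‖ₑ ^ (2 : ℝ)) x =
      4 * ‖g x‖ₑ ^ (2 : ℝ) *
        (Set.Iic a).indicator (fun s => ENNReal.ofReal (s ^ (q - 2 - 1))) s := fun s => by
    by_cases hs : s ∈ Set.Iic a
    · rw [Set.indicator_of_mem hs, Set.indicator_of_mem ((hmem s).2 hs)]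
      ring
    · rw [Set.indicator_of_notMem hs, Set.indicator_of_notMem (mt (hmem s).1 hs)]
      simp
  simp only [e]
  rw [lintegral_const_mul' _ _ (by finiteness), lintegral_indicator_rpow ha0 (by linarith),
    ← ofReal_norm, ENNReal.ofReal_rpow_of_pos hn, ENNReal.ofReal_rpow_of_pos hn,
    show (4 : ℝ≥0∞) = ENNReal.ofReal 4 by simp, ← ENNReal.ofReal_mul (by norm_num),
    ← ENNReal.ofReal_mul (by positivity),
    ← ENNReal.ofReal_mul (by have : 0 < q - 2 := by linarith
                             positivity)]
  refine ENNReal.ofReal_le_ofReal (le_of_eq ?_)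
  rw [ha, Real.mul_rpow (by norm_num) (by positivity), ← Real.rpow_mul hn.le,
    show p = 2 + (1 - p) * (q - 2) by linarith [hpq.sub_one_mul_conj], Real.rpow_add hn,
    ← show p = 2 + (1 - p) * (q - 2) by linarith [hpq.sub_one_mul_conj]]
  ring

/-- Layer-cake formula for the sum, the level-set count at each height, then Tonelli. -/
theorem tsum_fourierCoeff_rpow_le_of_measurable {p q : ℝ} (hp : 1 < p) (hp2 : p < 2)
    (hpq : p.HolderConjugate q) {g : Torus → ℂ} (hg : Measurable g)
    (hi : Integrable g haarAddCircle)
    (h1 : ∫⁻ x, ‖g x‖ₑ ^ p ∂haarAddCircle ≤ 1) :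
    ∑' k : ℤ, ‖fourierCoeff g k‖ₑ ^ q ≤ ENNReal.ofReal (q * 4 * (2 ^ (q - 2) / (q - 2))) := by
  have hq : 2 < q := by
    have := hpq.sub_one_mul_conj
    nlinarith [hpq.symm.pos]
  have hc : ∀ z : ℂ, ‖z‖ₑ ^ q = ENNReal.ofReal (‖z‖ ^ q) := fun z => by
    rw [← ENNReal.ofReal_rpow_of_nonneg (norm_nonneg _) (by linarith), ofReal_norm]
  have hmeas : Measurable fun z : ℝ × Torus => (truncationSet p g z.1).indicator
      (fun x => ‖g x‖ₑ ^ (2 : ℝ)) z.2 := by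
    have hm : MeasurableSet {z : ℝ × Torus | z.1 * ‖g z.2‖ ^ (p - 1) ≤ 2} :=
      measurableSet_le (measurable_fst.mul ((hg.comp measurable_snd).norm.pow_const _))
        measurable_const
    exact (((hg.comp measurable_snd).enorm.pow_const (2 : ℝ)).indicator hm)
  calc ∑' k : ℤ, ‖fourierCoeff g k‖ₑ ^ q
      = ENNReal.ofReal q * ∫⁻ s in Set.Ioi (0 : ℝ),
          Measure.count {k : ℤ | s < ‖fourierCoeff g k‖} * ENNReal.ofReal (s ^ (q - 1)) := by
        simp only [hc]
        rw [← lintegral_count, lintegral_rpow_eq_lintegral_meas_lt_mul _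
          (.of_forall fun _ => norm_nonneg _) (measurable_of_countable _).aemeasurable (by linarith)]
    _ ≤ ENNReal.ofReal q * ∫⁻ s in Set.Ioi (0 : ℝ), ∫⁻ x : Torus,
          4 * ENNReal.ofReal (s ^ (q - 2 - 1)) *
            (truncationSet p g s).indicator (fun x => ‖g x‖ₑ ^ (2 : ℝ)) x ∂haarAddCircle := by
        gcongr ENNReal.ofReal q * ?_
        refine setLIntegral_mono' measurableSet_Ioi fun s hs => ?_
        have hs : 0 < s := hs
        rw [lintegral_const_mul' _ _ (by finiteness)]
        -- Uses `s^(q-1) = 4 s^(q-3) (s/2)^2`.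
        refine le_trans (le_of_eq ?_) (mul_le_mul_right (count_fourierCoeff_le hp hg hi h1 hs) _)
        rw [← mul_assoc, mul_comm]
        congr 1
        rw [ENNReal.ofReal_rpow_of_pos (by positivity), show (4 : ℝ≥0∞) = ENNReal.ofReal 4 by simp,
          ← ENNReal.ofReal_mul (by norm_num), ← ENNReal.ofReal_mul (by positivity)]
        congr 1
        rw [show q - 1 = (q - 2 - 1) + 2 by ring, Real.rpow_add hs,
          Real.div_rpow hs.le (by norm_num)]
        norm_num
        ring
    _ = ENNReal.ofReal q * ∫⁻ x : Torus, (∫⁻ s in Set.Ioi (0 : ℝ),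
          4 * ENNReal.ofReal (s ^ (q - 2 - 1)) *
            (truncationSet p g s).indicator (fun x => ‖g x‖ₑ ^ (2 : ℝ)) x) ∂haarAddCircle := by
        rw [lintegral_lintegral_swap]
        refine Measurable.aemeasurable (Measurable.mul ?_ hmeas)
        fun_prop
    _ ≤ ENNReal.ofReal q * ∫⁻ x : Torus, ENNReal.ofReal (4 * (2 ^ (q - 2) / (q - 2))) * ‖g x‖ₑ ^ p
          ∂haarAddCircle := by
        gcongr with x
        exact lintegral_truncationSet_indicator_le hq hpq g x
    _ ≤ _ := by
        rw [lintegral_const_mul' _ _ ENNReal.ofReal_ne_top, mul_assoc q,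
          ENNReal.ofReal_mul (p := q) (by linarith)]
        gcongr
        exact mul_le_of_le_one_right' h1

theorem exists_hausdorffYoung {p q : ℝ} (hp : 1 < p) (hp2 : p < 2) (hpq : p.HolderConjugate q) :
    ∃ C : ℝ, 0 < C ∧ ∀ g : Torus → ℂ, MemLp g (ENNReal.ofReal p) haarAddCircle →
      ∑' k : ℤ, ‖fourierCoeff g k‖ₑ ^ q ≤
        ENNReal.ofReal C * eLpNorm g (ENNReal.ofReal p) haarAddCircle ^ q := by
  have hq : 2 < q := by
    have := hpq.sub_one_mul_conj
    nlinarith [hpq.symm.pos]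
  have hq2 : 0 < q - 2 := by linarith
  have hp0 : 0 < p := by linarith
  refine ⟨q * 4 * (2 ^ (q - 2) / (q - 2)), by positivity, fun g hg => ?_⟩
  wlog hm : Measurable g generalizing g with H
  · have hae := hg.1.ae_eq_mk
    have := H _ ((memLp_congr_ae hae).1 hg) hg.1.measurable_mk
    rwa [← fourierCoeff_congr_ae hae, ← eLpNorm_congr_ae hae] at this
  set N := eLpNorm g (ENNReal.ofReal p) haarAddCircle with hN
  have hNtop : N ≠ ∞ := hg.2.ne
  rcases eq_or_ne N 0 with h0 | h0
  · rw [hN, eLpNorm_eq_zero_iff hg.1 (by simpa using hp0)] at h0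
    have hz : fourierCoeff g = 0 := by
      rw [fourierCoeff_congr_ae h0]
      ext k
      simp [fourierCoeff]
    simp [hz, show 0 < q by linarith]
  have hNpos : 0 < N.toReal := ENNReal.toReal_pos h0 hNtop
  -- The truncation bound is not homogeneous in `g`, so `g` is scaled to norm one.
  set c : ℂ := ((N.toReal⁻¹ : ℝ) : ℂ) with hcdef
  have hc : ‖c‖ₑ = N⁻¹ := by
    rw [← ofReal_norm, Complex.norm_real, Real.norm_of_nonneg (by positivity),
      ENNReal.ofReal_inv_of_pos hNpos, ENNReal.ofReal_toReal hNtop]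
  have hcg : MemLp (c • g) (ENNReal.ofReal p) haarAddCircle := hg.const_smul c
  have h1 : ∫⁻ x, ‖(c • g) x‖ₑ ^ p ∂haarAddCircle ≤ 1 := by
    have h := eLpNorm_const_smul c g (ENNReal.ofReal p) haarAddCircle
    rw [hc, ← hN, ENNReal.inv_mul_cancel h0 hNtop, eLpNorm_eq_lintegral_rpow_enorm_toReal
      (by simpa using hp0) ENNReal.ofReal_ne_top, ENNReal.toReal_ofReal hp0.le] at h
    rw [← ENNReal.rpow_le_rpow_iff (z := 1 / p) (by positivity), h]
    simp
  have key := tsum_fourierCoeff_rpow_le_of_measurable hp hp2 hpq (hm.const_smul c)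
    (hcg.integrable (by simpa using hp.le)) h1
  have e : ∀ k, ‖fourierCoeff (c • g) k‖ₑ ^ q = (N ^ q)⁻¹ * ‖fourierCoeff g k‖ₑ ^ q := fun k => by
    rw [fourierCoeff.const_smul, enorm_smul, hc, ENNReal.mul_rpow_of_nonneg _ _ (by linarith),
      ENNReal.inv_rpow]
  simp only [e] at key
  rw [ENNReal.tsum_mul_left, mul_comm, ← div_eq_mul_inv] at key
  refine (ENNReal.div_le_iff_le_mul (Or.inl ?_) (Or.inl ?_)).1 key
  · simp [h0, hNtop]
  · exact ENNReal.rpow_ne_top_of_nonneg (by linarith) hNtop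

/-! ### Averages of the multiplier `2 - 2 cos (k h)` -/

theorem sq_le_two_sub_two_mul_cos {x : ℝ} (hx : |x| ≤ π) :
    4 / π ^ 2 * x ^ 2 ≤ 2 - 2 * Real.cos x := by
  have := Real.cos_le_one_sub_mul_cos_sq hx
  have e : 4 / π ^ 2 * x ^ 2 = 2 * (2 / π ^ 2 * x ^ 2) := by ring
  linarith

theorem two_sub_two_mul_cos_le_sq (x : ℝ) : 2 - 2 * Real.cos x ≤ x ^ 2 := by
  linarith [Real.one_sub_sq_div_two_le_cos (x := x)]

/-- Up to `π`, write `sin u = 2 sin (u/2) cos (u/2)` and use the quadratic upper bound for cosine;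
beyond `π`, the right side is at least `u/2 > 1`. -/
theorem sin_le_mul_one_sub {u : ℝ} (hu : 0 < u) :
    Real.sin u ≤ u * (1 - min 1 (u ^ 2) / (2 * π ^ 2)) := by
  have hpi := Real.pi_gt_three
  have hpos : (0 : ℝ) < π ^ 2 := by positivity
  rcases le_total u π with h | h
  · have h2 : Real.sin u = 2 * Real.sin (u / 2) * Real.cos (u / 2) := by
      rw [← Real.sin_two_mul]; ring_nf
    have hs : Real.sin (u / 2) ≤ u / 2 := Real.sin_le (by linarith)
    have hc : 0 ≤ Real.cos (u / 2) := Real.cos_nonneg_of_mem_Icc ⟨by linarith, by linarith⟩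
    have hq : Real.cos (u / 2) ≤ 1 - 2 / π ^ 2 * (u / 2) ^ 2 :=
      Real.cos_le_one_sub_mul_cos_sq (by rw [abs_of_pos (by linarith)]; linarith)
    have e : 2 / π ^ 2 * (u / 2) ^ 2 = u ^ 2 / (2 * π ^ 2) := by ring
    have hm : min 1 (u ^ 2) / (2 * π ^ 2) ≤ u ^ 2 / (2 * π ^ 2) := by
      gcongr
      exact min_le_right _ _
    calc Real.sin u ≤ u * Real.cos (u / 2) := by rw [h2]; nlinarith
      _ ≤ _ := by gcongr; linarith
  · have hm : min 1 (u ^ 2) / (2 * π ^ 2) ≤ 1 / 2 := by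
      rw [div_le_iff₀ (by positivity)]
      nlinarith [min_le_left 1 (u ^ 2)]
    nlinarith [Real.sin_le_one u]

theorem integral_two_sub_two_mul_cos_ge {t : ℝ} (ht : 0 < t) {k : ℝ} (hk : k ≠ 0) :
    t * (min 1 ((t * |k|) ^ 2) / π ^ 2) ≤ ∫ h in (0 : ℝ)..t, (2 - 2 * Real.cos (k * h)) := by
  have hk' : 0 < |k| := abs_pos.2 hk
  have e : ∫ h in (0 : ℝ)..t, (2 - 2 * Real.cos (k * h)) =
      2 * t - 2 * (Real.sin (t * |k|) / |k|) := by
    have : ∀ h, Real.cos (k * h) = Real.cos (|k| * h) := fun h => by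
      rcases abs_choice k with h' | h' <;> simp [h']
    simp only [this]
    rw [intervalIntegral.integral_sub (by simp)
      (Continuous.intervalIntegrable (by fun_prop) _ _), intervalIntegral.integral_const_mul,
      intervalIntegral.integral_comp_mul_left _ hk'.ne']
    simp
    ring_nf
  have hs := sin_le_mul_one_sub (mul_pos ht hk')
  have hd : Real.sin (t * |k|) / |k| ≤ t * (1 - min 1 ((t * |k|) ^ 2) / (2 * π ^ 2)) := by
    rw [div_le_iff₀ hk']
    linarith
  rw [e]
  have e2 : t * (min 1 ((t * |k|) ^ 2) / π ^ 2) =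
      2 * t * (min 1 ((t * |k|) ^ 2) / (2 * π ^ 2)) := by ring
  rw [e2]
  linarith

/-- An elementary substitute for Jensen's inequality: it turns a lower bound on a mean into one on
the mean of `q`-th powers. -/
theorem rpow_sub_one_mul_sub_le_rpow {a x q : ℝ} (ha : 0 < a) (hx : 0 ≤ x) (hq : 1 ≤ q) :
    a ^ (q - 1) * (x - a) ≤ x ^ q := by
  rcases le_total x a with h | h
  · exact (mul_nonpos_of_nonneg_of_nonpos (by positivity) (by linarith)).trans
      (Real.rpow_nonneg hx _)
  · have hx' : 0 < x := ha.trans_le h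
    calc a ^ (q - 1) * (x - a) ≤ x ^ (q - 1) * x := by gcongr; linarith
      _ = x ^ q := by rw [← Real.rpow_add_one hx'.ne']; ring_nf

theorem integral_two_sub_two_mul_cos_rpow_ge {t q : ℝ} (ht : 0 < t) (hq : 1 ≤ q) {k : ℝ}
    (hk : k ≠ 0) :
    t * (min 1 ((t * |k|) ^ 2) / (2 * π ^ 2)) ^ q ≤
      ∫ h in (0 : ℝ)..t, (2 - 2 * Real.cos (k * h)) ^ q := by
  -- Half the known lower bound for the mean, so that `a` still remains after subtracting `a`.
  set a := min 1 ((t * |k|) ^ 2) / (2 * π ^ 2) with ha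
  have ha0 : 0 < a := by
    have : 0 < t * |k| := mul_pos ht (abs_pos.2 hk)
    positivity
  have hm : t * (2 * a) ≤ ∫ h in (0 : ℝ)..t, (2 - 2 * Real.cos (k * h)) := by
    convert integral_two_sub_two_mul_cos_ge ht hk using 2
    rw [ha]; ring
  calc t * a ^ q = a ^ (q - 1) * (t * (2 * a) - t * a) := by
        conv_lhs => rw [show q = (q - 1) + 1 by ring, Real.rpow_add_one ha0.ne']
        ring
    _ ≤ a ^ (q - 1) * ((∫ h in (0 : ℝ)..t, (2 - 2 * Real.cos (k * h))) - t * a) := by gcongr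
    _ = ∫ h in (0 : ℝ)..t, a ^ (q - 1) * ((2 - 2 * Real.cos (k * h)) - a) := by
        rw [intervalIntegral.integral_const_mul, intervalIntegral.integral_sub
          (f := fun h => 2 - 2 * Real.cos (k * h)) (g := fun _ => a)
          (Continuous.intervalIntegrable (by fun_prop) _ _) intervalIntegrable_const,
          intervalIntegral.integral_const, sub_zero, smul_eq_mul]
    _ ≤ _ := by
        refine intervalIntegral.integral_mono_on ht.le
          (Continuous.intervalIntegrable (by fun_prop) _ _)
          (Continuous.intervalIntegrable ?_ _ _) fun h _ =>
            rpow_sub_one_mul_sub_le_rpow ha0 (two_sub_two_mul_cos_nonneg _) hq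
        exact Continuous.rpow_const (by fun_prop) fun _ => Or.inr (by linarith)

theorem ofReal_min_mul_le_lintegral {t q : ℝ} (ht : 0 < t) (hq : 1 ≤ q) (k : ℝ) :
    ENNReal.ofReal t * ENNReal.ofReal (min 1 ((t * |k|) ^ (2 * q))) ≤
      ENNReal.ofReal ((2 * π ^ 2) ^ q) *
        ∫⁻ h in Set.Ioo 0 t, ENNReal.ofReal ((2 - 2 * Real.cos (k * h)) ^ q) := by
  rcases eq_or_ne k 0 with rfl | hk
  · simp [Real.zero_rpow (show 2 * q ≠ 0 by linarith)]
  have hc : Continuous fun h : ℝ => (2 - 2 * Real.cos (k * h)) ^ q :=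
    Continuous.rpow_const (by fun_prop) fun _ => Or.inr (by linarith)
  rw [← ofReal_integral_eq_lintegral_ofReal
    ((hc.integrableOn_Icc (a := 0) (b := t)).mono_set Set.Ioo_subset_Icc_self)
    (.of_forall fun h => Real.rpow_nonneg (two_sub_two_mul_cos_nonneg _) _),
    ← integral_Ioc_eq_integral_Ioo, ← intervalIntegral.integral_of_le ht.le,
    ← ENNReal.ofReal_mul ht.le, ← ENNReal.ofReal_mul (by positivity)]
  refine ENNReal.ofReal_le_ofReal ?_
  have hu : 0 ≤ t * |k| := by positivity
  have e : min 1 ((t * |k|) ^ (2 * q)) = min 1 ((t * |k|) ^ 2) ^ q := by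
    rw [Real.rpow_mul hu, Real.rpow_two]
    rcases le_total 1 ((t * |k|) ^ 2) with h | h
    · rw [min_eq_left h, min_eq_left (Real.one_le_rpow h (by linarith)), Real.one_rpow]
    · rw [min_eq_right h, min_eq_right (Real.rpow_le_one (by positivity) h (by linarith))]
  calc t * min 1 ((t * |k|) ^ (2 * q))
      = (2 * π ^ 2) ^ q * (t * (min 1 ((t * |k|) ^ 2) / (2 * π ^ 2)) ^ q) := by
        rw [e, Real.div_rpow (by positivity) (by positivity)]
        field_simp
    _ ≤ _ := by
        gcongr
        exact integral_two_sub_two_mul_cos_rpow_ge ht hq hk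

theorem eLpNorm_secondDiff_le_secondModulus (p : ℝ) (f : Torus → ℂ) {t h : ℝ}
    (hh : h ∈ Set.Ioo 0 t) :
    eLpNorm (secondDiff f h) (ENNReal.ofReal p) haarAddCircle ≤ secondModulus p f t :=
  le_iSup₂ (f := fun h _ => eLpNorm (secondDiff f h) (ENNReal.ofReal p) haarAddCircle) h hh

/-! ### From bounds on Fourier coefficients to bounds by the modulus of continuity -/

/-- No single `h` serves all `k`, so the hypothesis is applied to every second difference with `0 <
h < t` and integrated in `h`, the sum and integral being interchanged. -/
theorem weightedCoeffSum_le_secondModulus {p q C : ℝ} (hp : 1 ≤ p) (hq : 1 ≤ q) (hC : 0 < C)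
    (H : ∀ g : Torus → ℂ, MemLp g (ENNReal.ofReal p) haarAddCircle →
      ∑' k : ℤ, ‖fourierCoeff g k‖ₑ ^ q ≤
        ENNReal.ofReal C * eLpNorm g (ENNReal.ofReal p) haarAddCircle ^ q)
    {f : Torus → ℂ} (hf : MemLp f (ENNReal.ofReal p) haarAddCircle) {t : ℝ} (ht : 0 < t) :
    weightedCoeffSum (2 * q) q f t ≤
      ENNReal.ofReal (2 * π ^ 2 * C ^ (1 / q)) * secondModulus p f t := by
  have hq0 : 0 < q := by linarith
  have hi : Integrable f haarAddCircle := hf.integrable (by simpa using hp)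
  set D : ℝ := (2 * π ^ 2) ^ q with hD
  have hD0 : 0 < D := by positivity
  have hterm : ∀ (k : ℤ) (h : ℝ), ‖fourierCoeff (secondDiff f h) k‖ₑ ^ q =
      ENNReal.ofReal ((2 - 2 * Real.cos (k * h)) ^ q) * ENNReal.ofReal (‖fourierCoeff f k‖ ^ q) := by
    intro k h
    have h0 := two_sub_two_mul_cos_nonneg (k * h)
    rw [← ofReal_norm, ENNReal.ofReal_rpow_of_nonneg (norm_nonneg _) hq0.le,
      norm_fourierCoeff_secondDiff hi, Real.mul_rpow h0 (norm_nonneg _),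
      ENNReal.ofReal_mul (by positivity)]
  have key : ENNReal.ofReal t * ∑' k : ℤ, ENNReal.ofReal
      (min 1 ((t * |(k : ℝ)|) ^ (2 * q)) * ‖fourierCoeff f k‖ ^ q) ≤
      ENNReal.ofReal t * (ENNReal.ofReal (D * C) * secondModulus p f t ^ q) := by
    calc _ = ∑' k : ℤ, ENNReal.ofReal t * ENNReal.ofReal (min 1 ((t * |(k : ℝ)|) ^ (2 * q))) *
            ENNReal.ofReal (‖fourierCoeff f k‖ ^ q) := by
          rw [← ENNReal.tsum_mul_left]
          congr with k
          rw [ENNReal.ofReal_mul (by positivity), mul_assoc]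
      _ ≤ ∑' k : ℤ, ENNReal.ofReal D *
            ∫⁻ h in Set.Ioo 0 t, ‖fourierCoeff (secondDiff f h) k‖ₑ ^ q := by
          refine ENNReal.tsum_le_tsum fun k => ?_
          simp only [hterm]
          rw [lintegral_mul_const' _ _ ENNReal.ofReal_ne_top, ← mul_assoc]
          exact mul_le_mul_left (ofReal_min_mul_le_lintegral ht hq k) _
      _ = ENNReal.ofReal D * ∫⁻ h in Set.Ioo 0 t,
            ∑' k : ℤ, ‖fourierCoeff (secondDiff f h) k‖ₑ ^ q := by
          rw [ENNReal.tsum_mul_left, lintegral_tsum]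
          intro k
          simp only [hterm]
          fun_prop
      _ ≤ ENNReal.ofReal D * ∫⁻ h in Set.Ioo 0 t,
            ENNReal.ofReal C * secondModulus p f t ^ q := by
          gcongr ENNReal.ofReal D * ?_
          refine setLIntegral_mono' measurableSet_Ioo fun h hh => ?_
          refine (H _ (memLp_secondDiff hf h)).trans ?_
          gcongr
          exact eLpNorm_secondDiff_le_secondModulus p f hh
      _ = _ := by
          rw [setLIntegral_const, Real.volume_Ioo, sub_zero, ENNReal.ofReal_mul hD0.le]
          ring
  rw [ENNReal.mul_le_mul_iff_right (by simpa using ht) ENNReal.ofReal_ne_top] at key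
  calc weightedCoeffSum (2 * q) q f t
      ≤ (ENNReal.ofReal (D * C) * secondModulus p f t ^ q) ^ (1 / q) :=
        ENNReal.rpow_le_rpow key (by positivity)
    _ = _ := by
        rw [ENNReal.mul_rpow_of_nonneg _ _ (by positivity), ← ENNReal.rpow_mul,
          mul_one_div_cancel hq0.ne', ENNReal.rpow_one, ENNReal.ofReal_rpow_of_pos (by positivity),
          Real.mul_rpow hD0.le hC.le, hD, ← Real.rpow_mul (by positivity),
          mul_one_div_cancel hq0.ne', Real.rpow_one]

/-! ### The endpoint `p = 1` -/

theorem iSup_fourierCoeff_le_secondModulus {f : Torus → ℂ} (hf : MemLp f 1 haarAddCircle) {t : ℝ}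
    (ht : 0 < t) :
    (⨆ k : ℤ, ENNReal.ofReal (min 1 ((t * |(k : ℝ)|) ^ 2) * ‖fourierCoeff f k‖)) ≤
      ENNReal.ofReal (π ^ 2) * secondModulus 1 f t := by
  have hpi := Real.pi_gt_three
  refine iSup_le fun k => ?_
  rcases eq_or_ne k 0 with rfl | hk
  · simp
  have hk' : 0 < |(k : ℝ)| := by simpa using hk
  -- The `t / 2` keeps `h` strictly below `t`; the other term keeps `|k h| ≤ 1`, where the
  -- multiplier is comparable to `(k h)^2`.
  set h := min (t / 2) (1 / |(k : ℝ)|) with hh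
  have h0 : 0 < h := by positivity
  have hmem : h ∈ Set.Ioo 0 t := ⟨h0, (min_le_left _ _).trans_lt (by linarith)⟩
  have habs : |(k : ℝ) * h| = min (t * |(k : ℝ)| / 2) 1 := by
    rw [abs_mul, abs_of_pos h0, hh, mul_min_of_nonneg _ _ hk'.le]
    congr 1
    · ring
    · field_simp
  have hle := sq_le_two_sub_two_mul_cos (x := k * h)
    (by rw [habs]; linarith [min_le_right (t * |(k : ℝ)| / 2) 1])
  have hmin : min 1 ((t * |(k : ℝ)|) ^ 2) ≤ 4 * (k * h) ^ 2 := by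
    rw [← sq_abs (k * h), habs]
    rcases le_total (t * |(k : ℝ)| / 2) 1 with h' | h'
    · rw [min_eq_left h']
      refine (min_le_right _ _).trans (le_of_eq (by ring))
    · rw [min_eq_right h']
      exact (min_le_left _ _).trans (by norm_num)
  have hb : min 1 ((t * |(k : ℝ)|) ^ 2) ≤ π ^ 2 * (2 - 2 * Real.cos (k * h)) := by
    refine hmin.trans ?_
    calc 4 * ((k : ℝ) * h) ^ 2 = π ^ 2 * (4 / π ^ 2 * (k * h) ^ 2) := by field_simp
      _ ≤ _ := by gcongr
  calc ENNReal.ofReal (min 1 ((t * |(k : ℝ)|) ^ 2) * ‖fourierCoeff f k‖)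
      ≤ ENNReal.ofReal (π ^ 2 * ‖fourierCoeff (secondDiff f h) k‖) := by
        rw [norm_fourierCoeff_secondDiff (hf.integrable le_rfl), ← mul_assoc]
        gcongr
    _ = ENNReal.ofReal (π ^ 2) * ‖fourierCoeff (secondDiff f h) k‖ₑ := by
        rw [ENNReal.ofReal_mul (by positivity), ofReal_norm]
    _ ≤ ENNReal.ofReal (π ^ 2) * eLpNorm (secondDiff f h) (ENNReal.ofReal 1) haarAddCircle := by
        gcongr
        rw [ENNReal.ofReal_one, eLpNorm_one_eq_lintegral_enorm]
        exact enorm_fourierCoeff_le_lintegral _ _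
    _ ≤ _ := by
        gcongr
        exact eLpNorm_secondDiff_le_secondModulus 1 f hmem

/-! ### The reverse inequality for `p = 2` -/

theorem tsum_enorm_fourierCoeff_sq_eq_eLpNorm {g : Torus → ℂ} (hg : MemLp g 2 haarAddCircle) :
    ∑' k : ℤ, ‖fourierCoeff g k‖ₑ ^ (2 : ℝ) = eLpNorm g 2 haarAddCircle ^ (2 : ℝ) := by
  rw [tsum_enorm_fourierCoeff_sq hg, eLpNorm_eq_lintegral_rpow_enorm_toReal (by simp) (by simp),
    ← ENNReal.rpow_mul]
  simp

/-- For every `h < t` the multiplier is at most `min(4, (t|k|)^2)`, and Parseval transfers this to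
norms. -/
theorem secondModulus_two_le_weightedCoeffSum {f : Torus → ℂ} (hf : MemLp f 2 haarAddCircle)
    (t : ℝ) :
    secondModulus 2 f t ≤ ENNReal.ofReal 4 * weightedCoeffSum 4 2 f t := by
  have hi : Integrable f haarAddCircle := hf.integrable (by simp)
  refine iSup₂_le fun h hh => ?_
  rw [ENNReal.ofReal_ofNat, ← ENNReal.rpow_le_rpow_iff (z := 2) (by norm_num),
    ← tsum_enorm_fourierCoeff_sq_eq_eLpNorm (memLp_secondDiff hf h), weightedCoeffSum,
    ENNReal.mul_rpow_of_nonneg _ _ (by norm_num), ← ENNReal.rpow_mul]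
  rw [show (1 / 2 * 2 : ℝ) = 1 by norm_num, ENNReal.rpow_one, ← ENNReal.tsum_mul_left]
  refine ENNReal.tsum_le_tsum fun k => ?_
  rw [← ofReal_norm, ENNReal.ofReal_rpow_of_nonneg (norm_nonneg _) (by norm_num),
    ENNReal.ofReal_rpow_of_nonneg (by norm_num) (by norm_num), ← ENNReal.ofReal_mul (by positivity),
    norm_fourierCoeff_secondDiff hi, Real.mul_rpow (two_sub_two_mul_cos_nonneg _) (norm_nonneg _),
    ← mul_assoc]
  refine ENNReal.ofReal_le_ofReal ?_
  gcongr
  have h0 := two_sub_two_mul_cos_nonneg (k * h)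
  have h4 : 2 - 2 * Real.cos (k * h) ≤ 4 := by linarith [Real.neg_one_le_cos (k * h)]
  have hsq : 2 - 2 * Real.cos (k * h) ≤ (t * |(k : ℝ)|) ^ 2 := by
    refine (two_sub_two_mul_cos_le_sq _).trans ?_
    rw [← sq_abs (k * h), abs_mul, abs_of_pos hh.1, mul_comm]
    have := hh.1.le
    have := hh.2.le
    gcongr
  rw [Real.rpow_two, Real.rpow_two, show (4 : ℝ) = ((4 : ℕ) : ℝ) by norm_num, Real.rpow_natCast,
    mul_min_of_nonneg _ _ (by positivity)]
  push_cast
  refine le_min (by nlinarith) ?_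
  calc (2 - 2 * Real.cos (k * h)) ^ 2 ≤ ((t * |(k : ℝ)|) ^ 2) ^ 2 := by gcongr
    _ ≤ 4 ^ 2 * (t * |(k : ℝ)|) ^ 4 := by
      rw [← pow_mul, show 2 * 2 = 4 from rfl]
      have : 0 ≤ (t * |(k : ℝ)|) ^ 4 := by positivity
      linarith

theorem mainTheorem9 :
    (∃ c : ℝ, 0 < c ∧ ∀ f : Torus → ℂ, MemLp f 1 haarAddCircle → ∀ t : ℝ, 0 < t →
      (⨆ k : ℤ, ENNReal.ofReal (min 1 ((t * |(k : ℝ)|) ^ 2) * ‖fourierCoeff f k‖)) ≤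
        ENNReal.ofReal c * secondModulus 1 f t) ∧
    (∀ p : ℝ, 1 < p → p < 2 →
      ∃ c : ℝ, 0 < c ∧ ∀ f : Torus → ℂ, MemLp f (ENNReal.ofReal p) haarAddCircle →
        ∀ t : ℝ, 0 < t →
          weightedCoeffSum (2 * p.conjExponent) p.conjExponent f t ≤
            ENNReal.ofReal c * secondModulus p f t) ∧
    (∃ c C : ℝ, 0 < c ∧ 0 < C ∧ ∀ f : Torus → ℂ, MemLp f 2 haarAddCircle → ∀ t : ℝ, 0 < t →
      ENNReal.ofReal c * secondModulus 2 f t ≤ weightedCoeffSum 4 2 f t ∧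
        weightedCoeffSum 4 2 f t ≤ ENNReal.ofReal C * secondModulus 2 f t) := by
  -- The factor `1 ^ (1 / 2)` is the general constant with Parseval's `C = 1`.
  refine ⟨⟨π ^ 2, by positivity, fun f hf t ht => iSup_fourierCoeff_le_secondModulus hf ht⟩,
    fun p hp hp2 => ?_, 4⁻¹, 2 * π ^ 2 * 1 ^ (1 / 2 : ℝ), by norm_num, by positivity,
    fun f hf t ht => ⟨?_, ?_⟩⟩
  · have hpq := Real.HolderConjugate.conjExponent hp
    obtain ⟨C, hC, H⟩ := exists_hausdorffYoung hp hp2 hpq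
    exact ⟨2 * π ^ 2 * C ^ (1 / p.conjExponent), by positivity, fun f hf t ht =>
      weightedCoeffSum_le_secondModulus hp.le hpq.symm.lt.le hC H hf ht⟩
  · calc ENNReal.ofReal 4⁻¹ * secondModulus 2 f t
        ≤ ENNReal.ofReal 4⁻¹ * (ENNReal.ofReal 4 * weightedCoeffSum 4 2 f t) := by
          gcongr
          exact secondModulus_two_le_weightedCoeffSum hf t
      _ = weightedCoeffSum 4 2 f t := by
          rw [← mul_assoc, ← ENNReal.ofReal_mul (by norm_num)]
          norm_num
  · have h := weightedCoeffSum_le_secondModulus (p := 2) (q := 2) one_le_two one_le_two one_pos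
      (fun g hg => by
        rw [ENNReal.ofReal_ofNat] at hg ⊢
        rw [tsum_enorm_fourierCoeff_sq_eq_eLpNorm hg, ENNReal.ofReal_one, one_mul])
      (by rwa [ENNReal.ofReal_ofNat]) ht
    rwa [show (2 * 2 : ℝ) = 4 by norm_num] at h
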